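/- Consider a Bayesian contextual bandit with a finite nonempty set of actions $\mathcal A$, a context space $\mathcal X$, a nonempty (Borel) parameter space $\mathcal O\subseteq\mathbb R^d$, a prior $\mathbb P_\Theta$ on $\mathcal O$, a context distribution $\mathbb P_X$ on $\mathcal X$, and a reward kernel giving the law on $\mathbb R$ of the random reward $R(x,a,\theta)$ for $x\in\mathcal X$, $a\in\mathcal A$, $\theta\in\mathcal O$. Let $\psi^\star:\mathcal X\times\mathcal O\to\mathcal A$ be a measurable rule such that $\psi^\star(x,\theta)$ maximizes $a\mapsto\mathbb E[R(x,a,\theta)]$ for $\mathbb P_X\otimes\mathbb P_\Theta$-almost every $(x,\theta)$. The parameter $\Theta\sim\mathbb P_\Theta$ is drawn once. At each round $t=1,\dots,T$, Thompson sampling observes a context $X_t\sim\mathbb P_X$ drawn independently of $\Theta$ and of the history $\hat H^t=(\hat A_s,X_s,R_s)_{s<t}$, draws $\hat\Theta_t$ from the posterior $\mathbb P_{\Theta\mid\hat H^t}$ (conditionally independently of $(\Theta,X_t)$ given $\hat H^t$), plays $\hat A_t=\psi^\star(X_t,\hat\Theta_t)$, and collects the reward $R_t=R(X_t,\hat A_t,\Theta)$;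 the reward of each action at round $t$ is drawn from the reward kernel at $(X_t,a,\Theta)$, conditionally on $\hat H^t,X_t,\hat\Theta_t,\Theta$. Let $R^\star_t=R(X_t,\psi^\star(X_t,\Theta),\Theta)$, let $\mathbb E_t[\cdot]=\mathbb E[\cdot\mid\hat H^t,X_t]$ (the mean of the conditional law), and define the $[0,\infty]$-valued random variables $$\mathrm I_t(\Theta;R_t\mid\hat A_t)=\mathbb E_t\big[D_{\mathrm{KL}}(\mathbb P_{R_t\mid\hat H^t,X_t,\hat A_t,\Theta}\,\|\,\mathbb P_{R_t\mid\hat H^t,X_t,\hat A_t})\big],\qquad \Gamma_t=\frac{\mathbb E_t[R^\star_t-R_t]^2}{\mathrm I_t(\Theta;R_t\mid\hat A_t)},$$ with the conventions $0/0=0$, $c/0=\infty$ for $c>0$, and $c/\infty=0$. Assume that for some feature map $m:\mathcal X\times\mathcal A\to\mathbb R^d$ the reward $R(x,a,\theta)$ is integrable with $\mathbb E[R(x,a,\theta)]=\langle\theta,m(x,a)\rangle$ for all $x\in\mathcal X$, $a\in\mathcal A$, $\theta\in\mathcal O$. Let $\sigma\ge 0$ and assume that for every $t\in\{1,\dots,T\}$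 and almost every value $(h,x,a)$ of $(\hat H^t,X_t,\hat A_t)$ the reward $R_t$ is $\sigma^2$-sub-Gaussian under $\mathbb P_{R_t\mid\hat H^t=h,X_t=x,\hat A_t=a}$, that is, under this law $\mathbb E[e^{s(R_t-\mathbb E R_t)}]\le e^{\sigma^2s^2/2}$ for all $s\in\mathbb R$. Then for every $t\in\{1,\dots,T\}$, almost surely, $R^\star_t-R_t$ is integrable under its conditional law given $(\hat H^t,X_t)$ and $$\Gamma_t\le 2\sigma^2 d .$$ -/

import Mathlib

open MeasureTheory ProbabilityTheory InformationTheory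
open scoped ENNReal NNReal

noncomputable section

/-- A Bayesian contextual bandit problem with contexts in `𝒳`, actions in `A` and environment
parameters in `O`: a prior, a context distribution and a reward kernel. -/
structure ContextualBandit (𝒳 A O : Type*) [MeasurableSpace 𝒳] [MeasurableSpace A]
    [MeasurableSpace O] where
  /-- distribution of the environment parameter -/
  prior : Measure O
  /-- distribution of the context at each round -/
  context : Measure 𝒳
  /-- distribution of the reward given the context, the action and the parameter -/
  reward : Kernel (𝒳 × A × O) ℝ
  prior_prob : IsProbabilityMeasure prior
  context_prob : IsProbabilityMeasure context
  reward_markov : IsMarkovKernel reward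

namespace ContextualBandit

variable {𝒳 A O : Type*} [MeasurableSpace 𝒳] [MeasurableSpace A] [MeasurableSpace O]

/-- The expected reward of action `a` in context `x` when the parameter is `θ`. -/
def meanReward (Φ : ContextualBandit 𝒳 A O) (x : 𝒳) (a : A) (θ : O) : ℝ :=
  ∫ r, r ∂(Φ.reward (x, a, θ))

/-- `ψ` is an optimal decision rule: knowing the parameter, it selects an action with the highest
expected reward (for almost every context and parameter). -/
structure IsOptimalRule (Φ : ContextualBandit 𝒳 A O) (ψ : 𝒳 × O → A) : Prop where
  measurable : Measurable ψ
  optimal : ∀ᵐ p ∂(Φ.context.prod Φ.prior), ∀ a : A,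
    Φ.meanReward p.1 a p.2 ≤ Φ.meanReward p.1 (ψ p) p.2

end ContextualBandit

/-- The random variables of a run over `T` rounds, on a sample space `Ω`, of an agent that plays the
decision rule `rule` at sampled parameters. -/
structure BanditRun (Ω 𝒳 A O : Type*) (T : ℕ) where
  /-- the decision rule `ψ⋆` -/
  rule : 𝒳 × O → A
  /-- the true parameter `Θ` -/
  param : Ω → O
  /-- the context `X_t` -/
  ctx : Fin T → Ω → 𝒳
  /-- the parameter sampled by the agent at round `t` -/
  sample : Fin T → Ω → O
  /-- the (random) reward function of round `t`: `potential t a` is `R(X_t, a, Θ)` -/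
  potential : Fin T → A → Ω → ℝ

namespace BanditRun

variable {Ω 𝒳 A O : Type*} {T : ℕ}

/-- The action taken at round `t`, `ψ⋆(X_t, Θ̂_t)`. -/
def action (D : BanditRun Ω 𝒳 A O T) (t : Fin T) (ω : Ω) : A :=
  D.rule (D.ctx t ω, D.sample t ω)

/-- The optimal action at round `t`, `ψ⋆(X_t, Θ)`. -/
def optAction (D : BanditRun Ω 𝒳 A O T) (t : Fin T) (ω : Ω) : A :=
  D.rule (D.ctx t ω, D.param ω)

/-- The reward `R_t` collected at round `t`. -/
def reward (D : BanditRun Ω 𝒳 A O T) (t : Fin T) (ω : Ω) : ℝ :=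
  D.potential t (D.action t ω) ω

/-- The reward `R⋆_t` of the optimal action at round `t`. -/
def optReward (D : BanditRun Ω 𝒳 A O T) (t : Fin T) (ω : Ω) : ℝ :=
  D.potential t (D.optAction t ω) ω

/-- The history before round `t`: actions, contexts and rewards of the rounds `s < t`. -/
def history (D : BanditRun Ω 𝒳 A O T) (t : Fin T) (ω : Ω) : Set.Iio t → A × 𝒳 × ℝ :=
  fun s => (D.action s ω, D.ctx s ω, D.reward s ω)

/-- The pair of the history before round `t` and the context of round `t`. -/
def obs (D : BanditRun Ω 𝒳 A O T) (t : Fin T) (ω : Ω) : (Set.Iio t → A × 𝒳 × ℝ) × 𝒳 :=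
  (D.history t ω, D.ctx t ω)

variable [MeasurableSpace Ω] [MeasurableSpace 𝒳] [MeasurableSpace A] [MeasurableSpace O]

/-- The run `D` is, under `P`, a run of the Thompson sampling algorithm on the problem `Φ`:
at each round the context is drawn from the context distribution, the sampled parameter is drawn
from the posterior of the parameter given the history, and the reward of each action is drawn from
the reward kernel. -/
structure IsThompsonSampling [StandardBorelSpace O] [Nonempty O] (D : BanditRun Ω 𝒳 A O T)
    (Φ : ContextualBandit 𝒳 A O) (P : Measure Ω) [IsFiniteMeasure P] : Prop where
  rule_optimal : Φ.IsOptimalRule D.rule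
  measurable_param : Measurable D.param
  measurable_ctx : ∀ t, Measurable (D.ctx t)
  measurable_sample : ∀ t, Measurable (D.sample t)
  measurable_potential : ∀ t a, Measurable (D.potential t a)
  law_param : HasLaw D.param Φ.prior P
  law_ctx : ∀ t, HasCondDistrib (D.ctx t) (fun ω => (D.history t ω, D.param ω))
    (Kernel.const _ Φ.context) P
  law_sample : ∀ t, HasCondDistrib (D.sample t) (fun ω => (D.obs t ω, D.param ω))
    ((condDistrib D.param (D.history t) P).comap
      (fun y : ((Set.Iio t → A × 𝒳 × ℝ) × 𝒳) × O => y.1.1) (by fun_prop)) P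
  law_potential : ∀ t a, HasCondDistrib (D.potential t a)
    (fun ω => (D.obs t ω, D.sample t ω, D.param ω))
    (Φ.reward.comap
      (fun y : ((Set.Iio t → A × 𝒳 × ℝ) × 𝒳) × O × O => (y.1.2, a, y.2.2)) (by fun_prop)) P

/-- The conditional law of the regret `R⋆_t - R_t` given the history and the context. -/
def condRegretLaw (D : BanditRun Ω 𝒳 A O T) (P : Measure Ω) [IsFiniteMeasure P] (t : Fin T) :
    Kernel ((Set.Iio t → A × 𝒳 × ℝ) × 𝒳) ℝ :=
  condDistrib (fun ω => D.optReward t ω - D.reward t ω) (D.obs t) P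

/-- The conditional expectation of the regret `R⋆_t - R_t` given the history and the context,
as the mean of the conditional law. -/
def condRegret (D : BanditRun Ω 𝒳 A O T) (P : Measure Ω) [IsFiniteMeasure P] (t : Fin T)
    (ω : Ω) : ℝ :=
  ∫ z, z ∂(D.condRegretLaw P t (D.obs t ω))

/-- The conditional law of the reward `R_t` given the history, the context and the action. -/
def condRewardLaw (D : BanditRun Ω 𝒳 A O T) (P : Measure Ω) [IsFiniteMeasure P] (t : Fin T) :
    Kernel (((Set.Iio t → A × 𝒳 × ℝ) × 𝒳) × A) ℝ :=
  condDistrib (D.reward t) (fun ω => (D.obs t ω, D.action t ω)) P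

/-- The conditional law of the reward `R_t` given the history, the context, the action and the
true parameter. -/
def condRewardLawParam (D : BanditRun Ω 𝒳 A O T) (P : Measure Ω) [IsFiniteMeasure P]
    (t : Fin T) : Kernel (((Set.Iio t → A × 𝒳 × ℝ) × 𝒳) × A × O) ℝ :=
  condDistrib (D.reward t) (fun ω => (D.obs t ω, D.action t ω, D.param ω)) P

/-- The disintegrated conditional mutual information between the parameter and the reward `R_t`
given the action, given the history and the context: the conditional expectation, given the history
and the context, of the relative entropy of the two conditional laws of `R_t` above. -/
def condMutualInfo [Finite A] [DiscreteMeasurableSpace A] [Nonempty A] [StandardBorelSpace O]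
    [Nonempty O] (D : BanditRun Ω 𝒳 A O T) (P : Measure Ω) [IsFiniteMeasure P] (t : Fin T)
    (ω : Ω) : ℝ≥0∞ :=
  ∫⁻ p, klDiv (D.condRewardLawParam P t (D.obs t ω, p)) (D.condRewardLaw P t (D.obs t ω, p.1))
    ∂(condDistrib (fun ω' => (D.action t ω', D.param ω')) (D.obs t) P (D.obs t ω))

/-- The lifted information ratio `Γ_t`. With the conventions of `ℝ≥0∞` it is `0` when numerator and
denominator both vanish, and `∞` when only the denominator does. -/
def liftedInfoRatio [Finite A] [DiscreteMeasurableSpace A] [Nonempty A] [StandardBorelSpace O]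
    [Nonempty O] (D : BanditRun Ω 𝒳 A O T) (P : Measure Ω) [IsFiniteMeasure P] (t : Fin T)
    (ω : Ω) : ℝ≥0∞ :=
  ENNReal.ofReal (D.condRegret P t ω ^ 2) / D.condMutualInfo P t ω

end BanditRun

/-- A probability law on the reals is `v`-sub-Gaussian: after centering at its mean, its moment
generating function at `s` is finite and at most `exp (v * s ^ 2 / 2)`. -/
def IsSubGaussianLaw (v : ℝ≥0) (ρ : Measure ℝ) : Prop :=
  HasSubgaussianMGF (fun r => r - ∫ s, s ∂ρ) v ρ

end

/-!
Fix the history `h` and the context `x`, and let `π` be the posterior of the parameter given `h`.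
The context is independent of the parameter given the history, so `π` is also the law of `Θ` given
`(h, x)`, and `Θ̂` is an independent copy of it (`hasCondDistrib_param_obs`,
`hasCondDistrib_param_obs_sample`). With `b θ = ψ⋆(x, θ)`, `ν` the law of `b` under `π`, and
`f a θ = ⟨θ, m x a⟩`, the conditional regret is therefore
`∫ (f (b θ) θ - ∫ f (b θ) dπ) dπ(θ)`: the action of Thompson sampling has the law of the optimal
action but is independent of the parameter. The conditional law of the reward given the action `a`
is the mixture over `π` of the reward kernel, and the conditional mutual information is
`I = ∫ ∫ KL(reward (x, a, θ) ‖ mixture a) dπ(θ) dν(a)`.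

Two inequalities bound the square of the regret by `2 σ² d I`.

* The Donsker-Varadhan inequality, applied to a linear function, turns sub-Gaussianity of the
  mixture into `(f a θ - ∫ f a dπ)² ≤ 2 σ² KL(reward (x, a, θ) ‖ mixture a)`
  (`IsSubGaussianLaw.ofReal_sq_sub_le_klDiv`), so that `∫ Var_π(f a) dν(a) ≤ 2 σ² I`.
* The centered functions `g a = f a - ∫ f a dπ` span a subspace `V` of `L²(π)` of dimension at most
  `d`. Expanding `g a = ∑ c a i • e i` in an orthonormal basis of `V` and using the Cauchy-Schwarz
  inequality on `∫ ∑ i, c (b θ) i * e i θ dπ(θ)`, whose second factor is `∑ i, ‖e i‖² = dim V`,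
  gives `(∫ g (b θ) θ dπ(θ))² ≤ dim V * ∫ ‖g (b θ)‖² dπ(θ)` (`sq_integral_select_le`). This replaces
  the usual comparison of the trace of a matrix with its rank and its Frobenius norm.

The only property of the rule `ψ⋆` that enters is its measurability.
-/

/-! ### Relative entropy and sub-Gaussian laws -/

/-- The **Donsker-Varadhan inequality**: it is the nonnegativity of the relative entropy of `μ` with
respect to the exponential tilting of `ν` by `f`. -/
theorem ofReal_integral_sub_log_integral_exp_le_klDiv {α : Type*} [MeasurableSpace α]
    {μ ν : Measure α} [IsProbabilityMeasure μ] [IsProbabilityMeasure ν] {f : α → ℝ}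
    (hfμ : Integrable f μ) (hfν : Integrable (fun x => Real.exp (f x)) ν) :
    ENNReal.ofReal (∫ x, f x ∂μ - Real.log (∫ x, Real.exp (f x) ∂ν)) ≤ klDiv μ ν := by
  by_cases hac : μ ≪ ν
  swap
  · simp [klDiv_of_not_ac hac]
  by_cases hint : Integrable (llr μ ν) μ
  swap
  · simp [klDiv_of_not_integrable hint]
  have := isProbabilityMeasure_tilted hfν
  have h := integral_llr_add_sub_measure_univ_nonneg
    (hac.trans (absolutelyContinuous_tilted hfν)) (integrable_llr_tilted_right hac hfμ hint hfν)
  rw [integral_llr_tilted_right hac hfμ hfν hint] at h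
  rw [klDiv_of_ac_of_integrable hac hint]
  simp only [probReal_univ] at h ⊢
  exact ENNReal.ofReal_le_ofReal (by linarith)

theorem IsSubGaussianLaw.integrable_id {v : ℝ≥0} {ρ : Measure ℝ} [IsProbabilityMeasure ρ]
    (h : IsSubGaussianLaw v ρ) : Integrable (fun r : ℝ => r) ρ := by
  refine ((HasSubgaussianMGF.integrable h).add (integrable_const (∫ s, s ∂ρ))).congr ?_
  exact ae_of_all _ fun r => sub_add_cancel r _

/-- Transport inequality for means under a sub-Gaussian reference law. The constant `c` is strictly
larger than `v` because the inequality may fail for `c = v = 0`: the right-hand side is then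
`0 * ∞ = 0` as soon as `μ` is not equal to `ρ`. -/
theorem IsSubGaussianLaw.ofReal_sq_sub_le_klDiv {v c : ℝ≥0} {μ ρ : Measure ℝ}
    [IsProbabilityMeasure μ] [IsProbabilityMeasure ρ] (h : IsSubGaussianLaw v ρ) (hvc : v < c)
    (hμ : Integrable (fun r : ℝ => r) μ) :
    ENNReal.ofReal ((∫ r, r ∂μ - ∫ r, r ∂ρ) ^ 2) ≤ 2 * c * klDiv μ ρ := by
  have hc : (0 : ℝ) < c := by exact_mod_cast pos_of_gt hvc
  have hvc' : (v : ℝ) ≤ c := by exact_mod_cast hvc.le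
  set Δ := ∫ r, r ∂μ - ∫ r, r ∂ρ with hΔ
  -- the slope `Δ / c` is the optimal one
  have hdv := ofReal_integral_sub_log_integral_exp_le_klDiv (μ := μ) (ν := ρ)
    (f := fun r => Δ / c * (r - ∫ s, s ∂ρ)) ((hμ.sub (integrable_const _)).const_mul _)
    (HasSubgaussianMGF.integrable_exp_mul h _)
  have h1 : ∫ r, Δ / c * (r - ∫ s, s ∂ρ) ∂μ = Δ ^ 2 / c := by
    rw [integral_const_mul, integral_sub hμ (integrable_const _)]
    simp only [integral_const, probReal_univ, one_smul]
    rw [← hΔ]; ring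
  have h2 : Real.log (∫ r, Real.exp (Δ / c * (r - ∫ s, s ∂ρ)) ∂ρ) ≤ Δ ^ 2 / (2 * c) := by
    refine (HasSubgaussianMGF.cgf_le h (Δ / c)).trans ?_
    calc (v : ℝ) * (Δ / c) ^ 2 / 2 ≤ c * (Δ / c) ^ 2 / 2 := by gcongr
      _ = Δ ^ 2 / (2 * c) := by field_simp
  have h3 : ENNReal.ofReal (Δ ^ 2 / (2 * c)) ≤ klDiv μ ρ := by
    refine le_trans (ENNReal.ofReal_le_ofReal ?_) hdv
    rw [h1]
    have : Δ ^ 2 / c = Δ ^ 2 / (2 * c) + Δ ^ 2 / (2 * c) := by field_simp; norm_num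
    linarith
  calc ENNReal.ofReal (Δ ^ 2) = ENNReal.ofReal (2 * c * (Δ ^ 2 / (2 * c))) := by
        congr 1; field_simp
    _ = 2 * c * ENNReal.ofReal (Δ ^ 2 / (2 * c)) := by
        rw [ENNReal.ofReal_mul (by positivity), ENNReal.ofReal_mul (by positivity)]
        simp
    _ ≤ _ := by gcongr

/-! ### Selecting one of finitely many functions -/

namespace MeasureTheory

section Select

variable {O A : Type*} [MeasurableSpace O] [MeasurableSpace A] [Finite A] {π : Measure O}
  {b : O → A}

/-- A property that holds almost everywhere for almost every fixed action also holds when the action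
is the function `b` of the point: `b` takes finitely many values, although `b θ` and `θ` are not
independent. -/
theorem ae_select {p : A → O → Prop} (hb : Measurable b)
    (h : ∀ᵐ a ∂(π.map b), ∀ᵐ θ ∂π, p a θ) : ∀ᵐ θ ∂π, p (b θ) θ := by
  have h' : ∀ᵐ θ ∂π, ∀ᵐ θ' ∂π, p (b θ) θ' := ae_of_ae_map hb.aemeasurable h
  have key : ∀ a, ∀ᵐ θ ∂π, b θ = a → p (b θ) θ := by
    intro a
    by_cases ha : ∀ᵐ θ' ∂π, p a θ'
    · filter_upwards [ha] with θ hθ hba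
      rwa [hba]
    · filter_upwards [h'] with θ hθ hba
      exact absurd (hba ▸ hθ) ha
  filter_upwards [ae_all_iff.2 key] with θ hθ
  exact hθ _ rfl

theorem integrable_select [DiscreteMeasurableSpace A] {F : A → O → ℝ} (hb : Measurable b)
    (h : ∀ᵐ a ∂(π.map b), Integrable (F a) π) : Integrable (fun θ => F (b θ) θ) π := by
  classical
  cases nonempty_fintype A
  have hs (a : A) : MeasurableSet (b ⁻¹' {a}) := hb (measurableSet_singleton a)
  have hsum : (fun θ => F (b θ) θ) = fun θ => ∑ a, (b ⁻¹' {a}).indicator (F a) θ := by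
    ext θ
    rw [Finset.sum_eq_single (b θ)]
    · simp
    · intro a _ ha
      exact Set.indicator_of_notMem (fun h => ha h.symm) _
    · simp
  rw [hsum]
  refine integrable_finsetSum _ fun a _ => ?_
  by_cases ha : Integrable (F a) π
  · exact ha.indicator (hs a)
  · have h0 : π (b ⁻¹' {a}) = 0 := by
      rw [← Measure.map_apply hb (measurableSet_singleton a)]
      exact measure_mono_null (Set.singleton_subset_iff.2 ha) h
    refine (integrable_zero O ℝ π).congr ?_
    have : ∀ᵐ θ ∂π, θ ∉ b ⁻¹' {a} := measure_eq_zero_iff_ae_notMem.1 h0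
    filter_upwards [this] with θ hθ
    simp [Set.indicator_of_notMem hθ]

/-- Selecting, by a function `b` of the point, among elements `g a` of a finite-dimensional subspace
`V` of `L²` yields a function whose squared integral is at most `dim V` times the mean of
`‖g (b θ)‖ ^ 2`. -/
theorem sq_integral_select_le [DiscreteMeasurableSpace A] [IsProbabilityMeasure π]
    (V : Submodule ℝ (Lp ℝ 2 π)) [FiniteDimensional ℝ V] (g : A → V) (hb : Measurable b) :
    (∫ θ, ((g (b θ) : Lp ℝ 2 π) : O → ℝ) θ ∂π) ^ 2
      ≤ Module.finrank ℝ V * ∫ θ, ‖g (b θ)‖ ^ 2 ∂π := by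
  classical
  set e := stdOrthonormalBasis ℝ V
  set c : A → Fin (Module.finrank ℝ V) → ℝ := fun a i => inner ℝ (e i) (g a) with hc
  have hsq (u : Lp ℝ 2 π) : Integrable (fun θ => (u : O → ℝ) θ ^ 2) π := (Lp.memLp u).integrable_sq
  have hone (u : Lp ℝ 2 π) : ∫ θ, (u : O → ℝ) θ ^ 2 ∂π = ‖u‖ ^ 2 := by
    rw [← real_inner_self_eq_norm_sq, L2.inner_def]
    simp [sq]
  have hg (a : A) : ∀ᵐ θ ∂π, ((g a : Lp ℝ 2 π) : O → ℝ) θ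
      = ∑ i, c a i * ((e i : Lp ℝ 2 π) : O → ℝ) θ := by
    have h1 : (g a : Lp ℝ 2 π) = ∑ i, c a i • (e i : Lp ℝ 2 π) := by
      rw [← congrArg Subtype.val (e.sum_repr' (g a)), Submodule.coe_sum]
      rfl
    have h2 := Lp.coeFn_finsetSum (E := ℝ) (p := 2) (μ := π) Finset.univ
      (fun i => c a i • (e i : Lp ℝ 2 π))
    have h3 : ∀ᵐ θ ∂π, ∀ i, ((c a i • (e i : Lp ℝ 2 π) : Lp ℝ 2 π) : O → ℝ) θ
        = c a i * ((e i : Lp ℝ 2 π) : O → ℝ) θ :=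
      ae_all_iff.2 fun i => Lp.coeFn_smul (c a i) (e i : Lp ℝ 2 π)
    rw [h1]
    filter_upwards [h2, h3] with θ h2 h3
    rw [h2, Finset.sum_apply]
    exact Finset.sum_congr rfl fun i _ => h3 i
  have hgb : ∀ᵐ θ ∂π, ((g (b θ) : Lp ℝ 2 π) : O → ℝ) θ
      = ∑ i, c (b θ) i * ((e i : Lp ℝ 2 π) : O → ℝ) θ :=
    ae_select hb (ae_of_all _ hg)
  have hint1 : Integrable (fun θ => ((g (b θ) : Lp ℝ 2 π) : O → ℝ) θ) π :=
    integrable_select (F := fun a => ((g a : Lp ℝ 2 π) : O → ℝ)) hb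
      (ae_of_all _ fun a => (Lp.memLp _).integrable (by norm_num))
  have hint2 : Integrable (fun θ => ‖g (b θ)‖ ^ 2) π :=
    integrable_select (F := fun a _ => ‖g a‖ ^ 2) hb (ae_of_all _ fun a => integrable_const _)
  have hint3 : Integrable (fun θ => ∑ i, ((e i : Lp ℝ 2 π) : O → ℝ) θ ^ 2) π :=
    integrable_finsetSum _ fun i _ => hsq _
  have hint3' : ∫ θ, ∑ i, ((e i : Lp ℝ 2 π) : O → ℝ) θ ^ 2 ∂π = Module.finrank ℝ V := by
    rw [integral_finsetSum _ fun i _ => hsq _]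
    have he (i : Fin (Module.finrank ℝ V)) : ‖(e i : Lp ℝ 2 π)‖ = 1 := e.orthonormal.1 i
    simp [hone, he]
  -- the quadratic polynomial in `s` is the integral of `∑ i, (s * c (b θ) i - e i θ) ^ 2`
  have hquad (s : ℝ) : 0 ≤ (∫ θ, ‖g (b θ)‖ ^ 2 ∂π) * (s * s)
      + (-2 * ∫ θ, ((g (b θ) : Lp ℝ 2 π) : O → ℝ) θ ∂π) * s + Module.finrank ℝ V := by
    have hnn : 0 ≤ ∫ θ, ((s * s) * ‖g (b θ)‖ ^ 2 - (2 * s) * ((g (b θ) : Lp ℝ 2 π) : O → ℝ) θ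
        + ∑ i, ((e i : Lp ℝ 2 π) : O → ℝ) θ ^ 2) ∂π := by
      refine integral_nonneg_of_ae ?_
      filter_upwards [hgb] with θ hθ
      have hn : ‖g (b θ)‖ ^ 2 = ∑ i, c (b θ) i ^ 2 := by
        rw [← e.sum_sq_norm_inner_right]
        simp [hc]
      have : (s * s) * ‖g (b θ)‖ ^ 2 - (2 * s) * ((g (b θ) : Lp ℝ 2 π) : O → ℝ) θ
          + ∑ i, ((e i : Lp ℝ 2 π) : O → ℝ) θ ^ 2
          = ∑ i, (s * c (b θ) i - ((e i : Lp ℝ 2 π) : O → ℝ) θ) ^ 2 := by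
        rw [hθ, hn, Finset.mul_sum, Finset.mul_sum, ← Finset.sum_sub_distrib,
          ← Finset.sum_add_distrib]
        exact Finset.sum_congr rfl fun i _ => by ring
      rw [Pi.zero_apply, this]
      exact Finset.sum_nonneg fun i _ => sq_nonneg _
    have hint4 : Integrable (fun θ => (s * s) * ‖g (b θ)‖ ^ 2
        - (2 * s) * ((g (b θ) : Lp ℝ 2 π) : O → ℝ) θ) π :=
      (hint2.const_mul _).sub (hint1.const_mul _)
    rw [integral_add hint4 hint3, integral_sub (hint2.const_mul _) (hint1.const_mul _), integral_const_mul,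
      integral_const_mul, hint3'] at hnn
    linarith
  have hd := discrim_le_zero hquad
  rw [discrim] at hd
  linarith

end Select

end MeasureTheory

/-! ### Centered linear functionals of a random parameter -/

/-- The form of `sq_integral_select_le` for the centered linear functionals
`θ ↦ ⟪ι θ, m a⟫ - ∫ ⟪ι θ', m a⟫`, which span a subspace of `L²` of dimension at most
`finrank ℝ E`. -/
theorem ofReal_sq_integral_centered_select_le {O A E : Type*} [MeasurableSpace O]
    [MeasurableSpace A] [DiscreteMeasurableSpace A] [Finite A] [NormedAddCommGroup E]
    [InnerProductSpace ℝ E] [FiniteDimensional ℝ E] {π : Measure O} [IsProbabilityMeasure π]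
    {b : O → A} (hb : Measurable b) (ι : O → E) (m : A → E)
    (h2 : ∀ᵐ a ∂(π.map b), MemLp (fun θ => inner ℝ (ι θ) (m a)) 2 π) :
    ENNReal.ofReal ((∫ θ, (inner ℝ (ι θ) (m (b θ)) - ∫ θ', inner ℝ (ι θ') (m (b θ)) ∂π) ∂π) ^ 2)
      ≤ Module.finrank ℝ E * ∫⁻ a, ∫⁻ θ, ENNReal.ofReal
        ((inner ℝ (ι θ) (m a) - ∫ θ', inner ℝ (ι θ') (m a) ∂π) ^ 2) ∂π ∂(π.map b) := by
  classical
  -- the directions `v` with `⟪ι ·, v⟫` in `L²`, on which centering is a linear map `L` into `L²`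
  let W : Submodule ℝ E :=
    { carrier := {v | MemLp (fun θ => inner ℝ (ι θ) v) 2 π}
      zero_mem' := by simp
      add_mem' := fun {u v} hu hv => by
        simpa only [Set.mem_ofPred_eq, inner_add_right] using! MemLp.add hu hv
      smul_mem' := fun r v hv => by
        simpa only [Set.mem_ofPred_eq, inner_smul_right] using! MemLp.const_mul hv r }
  have hint (w : W) : Integrable (fun θ => inner ℝ (ι θ) (w : E)) π :=
    MemLp.integrable (by norm_num) w.2
  have hmem (w : W) :
      MemLp (fun θ => inner ℝ (ι θ) (w : E) - ∫ θ', inner ℝ (ι θ') (w : E) ∂π) 2 π :=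
    MemLp.sub w.2 (memLp_const _)
  let L : W →ₗ[ℝ] Lp ℝ 2 π :=
    { toFun := fun w => (hmem w).toLp _
      map_add' := fun u v => by
        rw [← MemLp.toLp_add]
        congr 1
        ext θ
        simp only [Submodule.coe_add, inner_add_right, Pi.add_apply]
        rw [integral_add (hint u) (hint v)]
        ring
      map_smul' := fun r v => by
        rw [RingHom.id_apply, ← MemLp.toLp_const_smul]
        congr 1
        ext θ
        simp only [Submodule.coe_smul, inner_smul_right, Pi.smul_apply, smul_eq_mul]
        rw [integral_const_mul]
        ring }
  -- actions of probability zero may have `m a` outside `W`; they get the direction `0`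
  let w : A → W := fun a => if h : MemLp (fun θ => inner ℝ (ι θ) (m a)) 2 π then ⟨m a, h⟩ else 0
  let g : A → LinearMap.range L := fun a => L.rangeRestrict (w a)
  have hg : ∀ᵐ a ∂(π.map b), ∀ᵐ θ ∂π, ((g a : Lp ℝ 2 π) : O → ℝ) θ
      = inner ℝ (ι θ) (m a) - ∫ θ', inner ℝ (ι θ') (m a) ∂π := by
    filter_upwards [h2] with a ha
    have hw : w a = ⟨m a, ha⟩ := dif_pos ha
    have hga : (g a : Lp ℝ 2 π) = (hmem ⟨m a, ha⟩).toLp _ := congrArg L hw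
    rw [hga]
    exact (hmem ⟨m a, ha⟩).coeFn_toLp
  have hnorm : ∀ᵐ a ∂(π.map b), ENNReal.ofReal (‖g a‖ ^ 2) = ∫⁻ θ, ENNReal.ofReal
      ((inner ℝ (ι θ) (m a) - ∫ θ', inner ℝ (ι θ') (m a) ∂π) ^ 2) ∂π := by
    filter_upwards [hg] with a ha
    have h1 : ‖g a‖ ^ 2 = ∫ θ, ((g a : Lp ℝ 2 π) : O → ℝ) θ ^ 2 ∂π := by
      rw [Submodule.coe_norm, ← real_inner_self_eq_norm_sq, L2.inner_def]
      simp [sq]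
    rw [h1, ofReal_integral_eq_lintegral_ofReal (Lp.memLp _).integrable_sq
      (ae_of_all _ fun _ => sq_nonneg _)]
    refine lintegral_congr_ae ?_
    filter_upwards [ha] with θ hθ
    rw [hθ]
  have hfin : Module.finrank ℝ (LinearMap.range L) ≤ Module.finrank ℝ E :=
    (LinearMap.finrank_range_le L).trans (Submodule.finrank_le W)
  have hint2 : Integrable (fun θ => ‖g (b θ)‖ ^ 2) π :=
    integrable_select (F := fun a _ => ‖g a‖ ^ 2) hb (ae_of_all _ fun a => integrable_const _)
  calc _ = ENNReal.ofReal ((∫ θ, ((g (b θ) : Lp ℝ 2 π) : O → ℝ) θ ∂π) ^ 2) := by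
        rw [integral_congr_ae (ae_select (p := fun a θ => ((g a : Lp ℝ 2 π) : O → ℝ) θ
          = inner ℝ (ι θ) (m a) - ∫ θ', inner ℝ (ι θ') (m a) ∂π) hb hg)]
    _ ≤ ENNReal.ofReal (Module.finrank ℝ E * ∫ θ, ‖g (b θ)‖ ^ 2 ∂π) := by
        refine ENNReal.ofReal_le_ofReal ((sq_integral_select_le _ g hb).trans ?_)
        have : (0 : ℝ) ≤ ∫ θ, ‖g (b θ)‖ ^ 2 ∂π := integral_nonneg fun _ => sq_nonneg _
        gcongr
    _ = Module.finrank ℝ E * ∫⁻ θ, ENNReal.ofReal (‖g (b θ)‖ ^ 2) ∂π := by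
        rw [ENNReal.ofReal_mul (by positivity), ENNReal.ofReal_natCast,
          ofReal_integral_eq_lintegral_ofReal hint2 (ae_of_all _ fun _ => sq_nonneg _)]
    _ = Module.finrank ℝ E * ∫⁻ a, ENNReal.ofReal (‖g a‖ ^ 2) ∂(π.map b) := by
        rw [lintegral_map (.of_discrete) hb]
    _ = _ := by rw [lintegral_congr_ae hnorm]

/-! ### Information ratio for a fixed history and context -/

section Mixture

variable {α : Type*} [MeasurableSpace α] {μ : Measure α} {κ : Kernel α ℝ}

theorem integrable_mean_of_integrable_comp (h : Integrable (fun r : ℝ => r) (κ ∘ₘ μ)) :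
    Integrable (fun x => ∫ r, r ∂κ x) μ := by
  rw [Measure.comp_eq_comp_const_apply] at h
  exact h.integral_comp

theorem integral_comp_eq_integral_mean (h : Integrable (fun r : ℝ => r) (κ ∘ₘ μ)) :
    ∫ r, r ∂(κ ∘ₘ μ) = ∫ x, ∫ r, r ∂κ x ∂μ := by
  rw [Measure.comp_eq_comp_const_apply] at h ⊢
  exact Kernel.integral_comp h

theorem integrable_comp_of_integrable_integral_abs (h : ∀ x, Integrable (fun r : ℝ => r) (κ x))
    (h' : Integrable (fun x => ∫ r, |r| ∂κ x) μ) : Integrable (fun r : ℝ => r) (κ ∘ₘ μ) :=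
  (Measure.integrable_comp_iff measurable_id.aestronglyMeasurable).2 ⟨ae_of_all _ h, h'⟩

end Mixture

/-- The bound on the information ratio for a fixed history and context: `π` is the posterior, `b` the
decision rule, `κ` the reward kernel and `ρ` its mixture over `π`. The measure `τ` is the joint law
of the rewards of the optimal and of the played action, of which only the marginals matter. -/
theorem integrable_sub_and_sq_div_klDiv_le {O A E : Type*} [MeasurableSpace O]
    [MeasurableSpace A] [DiscreteMeasurableSpace A] [Finite A] [NormedAddCommGroup E]
    [InnerProductSpace ℝ E] [FiniteDimensional ℝ E] {π : Measure O} [IsProbabilityMeasure π]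
    {b : O → A} (hb : Measurable b) (ι : O → E) (m : A → E)
    (κ : Kernel (A × O) ℝ) [IsMarkovKernel κ] (hint : ∀ p, Integrable (fun r : ℝ => r) (κ p))
    (hlin : ∀ a θ, ∫ r, r ∂κ (a, θ) = inner ℝ (ι θ) (m a))
    (ρ : Kernel A ℝ) [IsMarkovKernel ρ] (hR : ∀ a, ρ a = κ.sectR a ∘ₘ π) {v : ℝ≥0}
    (hsub : ∀ᵐ a ∂(π.map b), IsSubGaussianLaw v (ρ a))
    (τ : Measure (ℝ × ℝ))
    (hτ₁ : τ.map Prod.fst = κ.comap (fun θ => (b θ, θ)) (by fun_prop) ∘ₘ π)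
    (hτ₂ : τ.map Prod.snd = ρ ∘ₘ (π.map b)) :
    Integrable (fun z : ℝ => z) (τ.map fun p => p.1 - p.2) ∧
      ENNReal.ofReal ((∫ z, z ∂(τ.map fun p => p.1 - p.2)) ^ 2) /
        (∫⁻ p, klDiv (κ p) (ρ p.1) ∂((π.map b).prod π)) ≤ 2 * v * Module.finrank ℝ E := by
  have hπb : IsProbabilityMeasure (π.map b) := Measure.isProbabilityMeasure_map hb.aemeasurable
  set f : A → O → ℝ := fun a θ => inner ℝ (ι θ) (m a) with hf
  have hRint : ∀ᵐ a ∂(π.map b), Integrable (fun r : ℝ => r) (ρ a) := by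
    filter_upwards [hsub] with a ha using ha.integrable_id
  have hfint : ∀ᵐ a ∂(π.map b), Integrable (f a) π := by
    filter_upwards [hRint] with a ha
    rw [hR] at ha
    simpa only [Kernel.sectR_apply, hlin] using integrable_mean_of_integrable_comp ha
  have hRmean : ∀ᵐ a ∂(π.map b), ∫ r, r ∂ρ a = ∫ θ, f a θ ∂π := by
    filter_upwards [hRint] with a ha
    rw [hR] at ha ⊢
    simpa only [Kernel.sectR_apply, hlin] using integral_comp_eq_integral_mean ha
  -- `|r|` has finite mean under `κ (b θ, θ)` averaged over `θ`, as it does under each mixture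
  have hint₁ : Integrable (fun r : ℝ => r) (τ.map Prod.fst) := by
    rw [hτ₁]
    refine integrable_comp_of_integrable_integral_abs (fun θ => hint _) ?_
    refine integrable_select (F := fun a θ => ∫ r, |r| ∂κ (a, θ)) hb ?_
    filter_upwards [hRint] with a ha
    rw [hR] at ha
    exact ((Measure.integrable_comp_iff ha.1).1 ha).2
  have hint₂ : Integrable (fun r : ℝ => r) (τ.map Prod.snd) := by
    rw [hτ₂]
    refine (Measure.integrable_comp_iff measurable_id.aestronglyMeasurable).2 ⟨hRint, ?_⟩
    exact Integrable.of_finite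
  have hint₁' : Integrable (fun p : ℝ × ℝ => p.1) τ := hint₁.comp_measurable measurable_fst
  have hint₂' : Integrable (fun p : ℝ × ℝ => p.2) τ := hint₂.comp_measurable measurable_snd
  have hmean₁ : ∫ p, p.1 ∂τ = ∫ θ, f (b θ) θ ∂π := by
    rw [← integral_map (φ := Prod.fst) (f := fun r : ℝ => r) measurable_fst.aemeasurable
      measurable_id.aestronglyMeasurable]
    rw [hτ₁] at hint₁ ⊢
    rw [integral_comp_eq_integral_mean hint₁]
    simp only [Kernel.comap_apply, hlin, hf]
  have hmean₂ : ∫ p, p.2 ∂τ = ∫ θ, (∫ θ', f (b θ) θ' ∂π) ∂π := by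
    rw [← integral_map (φ := Prod.snd) (f := fun r : ℝ => r) measurable_snd.aemeasurable
      measurable_id.aestronglyMeasurable]
    rw [hτ₂] at hint₂ ⊢
    rw [integral_comp_eq_integral_mean hint₂, integral_congr_ae hRmean,
      integral_map (f := fun a => ∫ θ', f a θ' ∂π) hb.aemeasurable
        Measurable.of_discrete.aestronglyMeasurable]
  have hmean : ∫ z, z ∂(τ.map fun p => p.1 - p.2)
      = ∫ θ, (f (b θ) θ - ∫ θ', f (b θ) θ' ∂π) ∂π := by
    rw [integral_map (f := fun r : ℝ => r) (by fun_prop) measurable_id.aestronglyMeasurable,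
      integral_sub hint₁' hint₂', hmean₁, hmean₂, integral_sub]
    · exact integrable_select hb hfint
    · exact integrable_select (F := fun a _ => ∫ θ', f a θ' ∂π) hb
        (ae_of_all _ fun a => integrable_const _)
  refine ⟨(integrable_map_measure measurable_id.aestronglyMeasurable (by fun_prop)).2
    (hint₁'.sub hint₂'), ?_⟩
  set I := ∫⁻ p, klDiv (κ p) (ρ p.1) ∂((π.map b).prod π) with hI
  by_cases hItop : I = ∞
  · simp [hItop]
  refine ENNReal.div_le_of_le_mul ?_
  set J := ∫⁻ a, ∫⁻ θ, ENNReal.ofReal ((f a θ - ∫ θ', f a θ' ∂π) ^ 2) ∂π ∂(π.map b) with hJ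
  have hmeas : Measurable fun p : A × O =>
      ENNReal.ofReal ((f p.1 p.2 - ∫ θ', f p.1 θ' ∂π) ^ 2) := by
    have h1 : Measurable fun p : A × O => f p.1 p.2 := by
      have : (fun p : A × O => f p.1 p.2) = fun p => ∫ r, r ∂κ p := by
        ext p; exact (hlin p.1 p.2).symm
      rw [this]
      exact (StronglyMeasurable.integral_kernel (κ := κ) stronglyMeasurable_id).measurable
    have h2 : Measurable fun p : A × O => ∫ θ', f p.1 θ' ∂π :=
      (Measurable.of_discrete (f := fun a => ∫ θ', f a θ' ∂π)).comp measurable_fst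
    fun_prop
  have hJc (c : ℝ≥0) (hc : v < c) : J ≤ 2 * c * I := by
    rw [hJ, ← lintegral_prod (fun p : A × O =>
      ENNReal.ofReal ((f p.1 p.2 - ∫ θ', f p.1 θ' ∂π) ^ 2)) hmeas.aemeasurable, hI,
      ← lintegral_const_mul' _ _ (ENNReal.mul_ne_top (by simp) (by simp))]
    -- no measurability of the relative entropy in `p` is needed for this comparison
    refine lintegral_mono_ae ?_
    filter_upwards [Measure.quasiMeasurePreserving_fst.ae hsub,
      Measure.quasiMeasurePreserving_fst.ae hRmean] with p hp hp'
    rw [← hp']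
    simpa only [hlin] using hp.ofReal_sq_sub_le_klDiv hc (hint (p.1, p.2))
  have hJtop : J ≠ ∞ :=
    ne_top_of_le_ne_top (ENNReal.mul_ne_top (by finiteness) hItop) (hJc (v + 1) (by simp))
  -- a limit in the constant gives the bound with `v` itself, also if `v = 0`
  have hJv : J ≤ 2 * v * I := by
    have hcont : Continuous fun c : ℝ≥0 => 2 * (c : ℝ≥0∞) * I := by
      simp only [mul_assoc]
      exact (ENNReal.continuous_const_mul (by simp)).comp
        ((ENNReal.continuous_mul_const hItop).comp ENNReal.continuous_coe)
    refine ge_of_tendsto (x := nhdsWithin v (Set.Ioi v)) (hcont.tendsto v |>.mono_left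
      nhdsWithin_le_nhds) ?_
    filter_upwards [self_mem_nhdsWithin] with c hc using hJc c hc
  have hL2 : ∀ᵐ a ∂(π.map b), MemLp (f a) 2 π := by
    have hlt : ∀ᵐ a ∂(π.map b),
        ∫⁻ θ, ENNReal.ofReal ((f a θ - ∫ θ', f a θ' ∂π) ^ 2) ∂π < ∞ :=
      ae_lt_top .of_discrete hJtop
    filter_upwards [hlt, hfint] with a ha ha'
    have hm : AEStronglyMeasurable (fun θ => f a θ - ∫ θ', f a θ' ∂π) π :=
      (ha'.sub (integrable_const _)).aestronglyMeasurable
    have h1 : MemLp (fun θ => f a θ - ∫ θ', f a θ' ∂π) 2 π := by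
      refine (memLp_two_iff_integrable_sq hm).2 ⟨hm.pow 2, ?_⟩
      rw [hasFiniteIntegral_iff_ofReal (ae_of_all _ fun _ => sq_nonneg _)]
      exact ha
    refine (h1.add (memLp_const (∫ θ', f a θ' ∂π))).ae_eq ?_
    exact ae_of_all _ fun θ => sub_add_cancel _ _
  rw [hmean]
  calc _ ≤ Module.finrank ℝ E * J := ofReal_sq_integral_centered_select_le hb ι m hL2
    _ ≤ Module.finrank ℝ E * (2 * v * I) := by gcongr
    _ = _ := by ring

/-! ### Conditional distributions -/

namespace ProbabilityTheory

section CondDistrib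

variable {Ω 𝓧 𝓨 𝓩 : Type*} [MeasurableSpace Ω] [MeasurableSpace 𝓧] [MeasurableSpace 𝓨]
  [MeasurableSpace 𝓩] {P : Measure Ω} {X : Ω → 𝓧} {Y : Ω → 𝓨} {Z : Ω → 𝓩}

theorem hasCondDistrib_condDistrib [IsFiniteMeasure P] [StandardBorelSpace 𝓨] [Nonempty 𝓨]
    (hX : Measurable X) (hY : Measurable Y) : HasCondDistrib Y X (condDistrib Y X P) P where
  aemeasurable := by fun_prop
  map_eq := (compProd_map_condDistrib hY.aemeasurable).symm

theorem HasCondDistrib.condDistrib_ae_eq [IsFiniteMeasure P] [StandardBorelSpace 𝓨] [Nonempty 𝓨]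
    {κ : Kernel 𝓧 𝓨} [IsFiniteKernel κ] (h : HasCondDistrib Y X κ P) :
    condDistrib Y X P =ᵐ[P.map X] κ :=
  condDistrib_ae_eq_of_measure_eq_compProd X h.aemeasurable_snd h.map_eq

theorem hasCondDistrib_deterministic [SFinite P] (hX : Measurable X) {g : 𝓧 → 𝓨}
    (hg : Measurable g) :
    HasCondDistrib (fun ω => g (X ω)) X (Kernel.deterministic g hg) P where
  aemeasurable := by fun_prop
  map_eq := by
    rw [Measure.compProd_deterministic, Measure.map_map (by fun_prop) hX]
    rfl

/-- The chain rule for conditional distributions, a converse of `HasCondDistrib.of_compProd`. -/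
theorem HasCondDistrib.prodMk [SFinite P] {κ : Kernel 𝓧 𝓨} {η : Kernel (𝓧 × 𝓨) 𝓩}
    [IsSFiniteKernel κ] [IsSFiniteKernel η] (hY : HasCondDistrib Y X κ P)
    (hZ : HasCondDistrib Z (fun ω => (X ω, Y ω)) η P) :
    HasCondDistrib (fun ω => (Y ω, Z ω)) X (κ ⊗ₖ η) P where
  aemeasurable := by
    have := hY.aemeasurable
    have := hZ.aemeasurable_snd
    have := hY.aemeasurable_fst
    have := hY.aemeasurable_snd
    fun_prop
  map_eq := by
    have h1 := hY.aemeasurable_fst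
    have h2 := hY.aemeasurable_snd
    have h3 := hZ.aemeasurable_snd
    have h4 : P.map (fun ω => (X ω, Y ω, Z ω))
        = (P.map (fun ω => ((X ω, Y ω), Z ω))).map MeasurableEquiv.prodAssoc := by
      rw [AEMeasurable.map_map_of_aemeasurable (by fun_prop) (by fun_prop)]
      rfl
    rw [h4, hZ.map_eq, hY.map_eq, Measure.compProd_assoc']

theorem HasCondDistrib.snd_compProd [SFinite P] {κ : Kernel 𝓧 𝓨} {η : Kernel (𝓧 × 𝓨) 𝓩}
    [IsSFiniteKernel κ] [IsSFiniteKernel η] (hY : HasCondDistrib Y X κ P)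
    (hZ : HasCondDistrib Z (fun ω => (X ω, Y ω)) η P) :
    HasCondDistrib Z X (κ ⊗ₖ η).snd P :=
  (hY.prodMk hZ).snd

theorem Kernel.compProd_prodMkRight_apply (κ : Kernel 𝓧 𝓨) (η : Kernel 𝓧 𝓩) [IsSFiniteKernel κ]
    [IsSFiniteKernel η] (x : 𝓧) : (κ ⊗ₖ η.prodMkRight 𝓨) x = (κ x).prod (η x) := by
  rw [Kernel.compProd_apply_eq_compProd_sectR, ← Measure.compProd_const]
  rfl

theorem Kernel.snd_compProd_apply_eq_comp_sectR (κ : Kernel 𝓧 𝓨) (η : Kernel (𝓧 × 𝓨) 𝓩)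
    [IsSFiniteKernel κ] [IsSFiniteKernel η] (x : 𝓧) :
    (κ ⊗ₖ η).snd x = η.sectR x ∘ₘ κ x := by
  rw [Kernel.snd_apply, Kernel.compProd_apply_eq_compProd_sectR, ← Measure.snd_compProd]
  rfl

/-- Conditional independence is symmetric: if, given `X` and `Y`, the law of `Z` depends on `X` only,
then, given `X` and `Z`, the law of `Y` depends on `X` only. -/
theorem HasCondDistrib.swap_of_prodMkRight [SFinite P] {κ : Kernel 𝓧 𝓨} {η : Kernel 𝓧 𝓩}
    [IsMarkovKernel κ] [IsMarkovKernel η] (hY : HasCondDistrib Y X κ P)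
    (hZ : HasCondDistrib Z (fun ω => (X ω, Y ω)) (η.prodMkRight 𝓨) P) :
    HasCondDistrib Y (fun ω => (X ω, Z ω)) (κ.prodMkRight 𝓩) P := by
  have h := (hY.prodMk hZ).comp_left measurable_swap
  have hk : (κ ⊗ₖ η.prodMkRight 𝓨).map Prod.swap = η ⊗ₖ κ.prodMkRight 𝓩 := by
    ext1 x
    rw [Kernel.map_apply _ measurable_swap, Kernel.compProd_prodMkRight_apply,
      Kernel.compProd_prodMkRight_apply, Measure.prod_swap]
  rw [hk] at h
  exact HasCondDistrib.of_compProd (Y := Z) h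

/-- If each `U a` has conditional distribution `κ a` given `X`, then so does the variable
`U (b (X ω)) ω` with `κ (b x) x`, whatever the joint law of the `U a`. -/
theorem HasCondDistrib.select {A : Type*} [MeasurableSpace A] [DiscreteMeasurableSpace A]
    [Countable A] [SFinite P] {U : A → Ω → 𝓨} {κ : A → Kernel 𝓧 𝓨} [∀ a, IsSFiniteKernel (κ a)]
    {η : Kernel 𝓧 𝓨} [IsSFiniteKernel η] {b : 𝓧 → A} (hX : Measurable X) (hb : Measurable b)
    (hU : ∀ a, Measurable (U a)) (h : ∀ a, HasCondDistrib (U a) X (κ a) P)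
    (hη : ∀ x, η x = κ (b x) x) :
    HasCondDistrib (fun ω => U (b (X ω)) ω) X η P := by
  have hmeas : Measurable fun ω => U (b (X ω)) ω :=
    (measurable_from_prod_countable_right hU : Measurable fun p : A × Ω => U p.1 p.2).comp
      ((hb.comp hX).prodMk measurable_id)
  refine ⟨(hX.prodMk hmeas).aemeasurable, ?_⟩
  refine (Measure.ext_iff_of_iUnion_eq_univ (s := fun a => {q : 𝓧 × 𝓨 | b q.1 = a}) ?_).2 ?_
  · ext q; simp
  intro a
  have hs : MeasurableSet {q : 𝓧 × 𝓨 | b q.1 = a} :=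
    (hb.comp measurable_fst) (measurableSet_singleton a)
  ext t ht
  rw [Measure.restrict_apply ht, Measure.restrict_apply ht,
    Measure.map_apply (hX.prodMk hmeas) (ht.inter hs), Measure.compProd_apply (ht.inter hs)]
  have h1 : (fun ω => (X ω, U (b (X ω)) ω)) ⁻¹' (t ∩ {q | b q.1 = a})
      = (fun ω => (X ω, U a ω)) ⁻¹' (t ∩ {q | b q.1 = a}) := by
    ext ω
    simp only [Set.mem_preimage, Set.mem_inter_iff, Set.mem_ofPred_eq]
    refine and_congr_left fun h => ?_
    rw [h]
  have hUa := hU a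
  rw [h1, ← Measure.map_apply (by fun_prop) (ht.inter hs), (h a).map_eq,
    Measure.compProd_apply (ht.inter hs)]
  refine lintegral_congr fun x => ?_
  by_cases hx : b x = a
  · rw [hη, hx]
  · have : Prod.mk x ⁻¹' (t ∩ {q : 𝓧 × 𝓨 | b q.1 = a}) = ∅ := by
      ext y; simp [hx]
    simp [this]

end CondDistrib

end ProbabilityTheory

/-! ### Conditional laws in Thompson sampling -/

namespace BanditRun.IsThompsonSampling

variable {Ω 𝒳 A O : Type*} {T : ℕ} [MeasurableSpace Ω] [MeasurableSpace 𝒳] [MeasurableSpace A]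
  [MeasurableSpace O] [StandardBorelSpace O] [Nonempty O]
  {P : Measure Ω} [IsProbabilityMeasure P] {Φ : ContextualBandit 𝒳 A O} {D : BanditRun Ω 𝒳 A O T}

theorem measurable_action (h : D.IsThompsonSampling Φ P) (t : Fin T) : Measurable (D.action t) :=
  h.rule_optimal.measurable.comp ((h.measurable_ctx t).prodMk (h.measurable_sample t))

theorem measurable_optAction (h : D.IsThompsonSampling Φ P) (t : Fin T) :
    Measurable (D.optAction t) :=
  h.rule_optimal.measurable.comp ((h.measurable_ctx t).prodMk h.measurable_param)

variable [DiscreteMeasurableSpace A] [Finite A]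

theorem measurable_potential_comp (h : D.IsThompsonSampling Φ P) (t : Fin T) {f : Ω → A}
    (hf : Measurable f) : Measurable fun ω => D.potential t (f ω) ω :=
  (measurable_from_prod_countable_right (h.measurable_potential t) :
    Measurable fun p : A × Ω => D.potential t p.1 p.2).comp (hf.prodMk measurable_id)

theorem measurable_reward (h : D.IsThompsonSampling Φ P) (t : Fin T) : Measurable (D.reward t) :=
  h.measurable_potential_comp t (h.measurable_action t)

theorem measurable_optReward (h : D.IsThompsonSampling Φ P) (t : Fin T) :
    Measurable (D.optReward t) :=
  h.measurable_potential_comp t (h.measurable_optAction t)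

theorem measurable_history (h : D.IsThompsonSampling Φ P) (t : Fin T) :
    Measurable (D.history t) :=
  measurable_pi_lambda _ fun s => (h.measurable_action s).prodMk
    ((h.measurable_ctx s).prodMk (h.measurable_reward s))

theorem measurable_obs (h : D.IsThompsonSampling Φ P) (t : Fin T) : Measurable (D.obs t) :=
  (h.measurable_history t).prodMk (h.measurable_ctx t)

end BanditRun.IsThompsonSampling

namespace BanditRun

variable {Ω 𝒳 A O : Type*} {T : ℕ} [MeasurableSpace Ω] [MeasurableSpace 𝒳] [MeasurableSpace A]
  [DiscreteMeasurableSpace A] [Finite A] [MeasurableSpace O] [StandardBorelSpace O] [Nonempty O]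

/-- The posterior of the parameter given the history before round `t`, as a kernel from the history
and the context of round `t`, constant in the context. -/
noncomputable def posterior (D : BanditRun Ω 𝒳 A O T) (P : Measure Ω) [IsFiniteMeasure P]
    (t : Fin T) : Kernel ((Set.Iio t → A × 𝒳 × ℝ) × 𝒳) O :=
  (condDistrib D.param (D.history t) P).prodMkRight 𝒳

instance (D : BanditRun Ω 𝒳 A O T) (P : Measure Ω) [IsFiniteMeasure P] (t : Fin T) :
    IsMarkovKernel (D.posterior P t) := by
  unfold posterior; infer_instance

end BanditRun

namespace BanditRun.IsThompsonSampling

variable {Ω 𝒳 A O : Type*} {T : ℕ} [MeasurableSpace Ω] [MeasurableSpace 𝒳] [MeasurableSpace A]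
  [DiscreteMeasurableSpace A] [Finite A] [MeasurableSpace O] [StandardBorelSpace O] [Nonempty O]
  {P : Measure Ω} [IsProbabilityMeasure P] {Φ : ContextualBandit 𝒳 A O} {D : BanditRun Ω 𝒳 A O T}

/-- Observing the context of round `t` does not change the law of the parameter. -/
theorem hasCondDistrib_param_obs (h : D.IsThompsonSampling Φ P) (t : Fin T) :
    HasCondDistrib D.param (D.obs t) (D.posterior P t) P := by
  have := Φ.context_prob
  exact (hasCondDistrib_condDistrib (h.measurable_history t)
    h.measurable_param).swap_of_prodMkRight (η := Kernel.const _ Φ.context) (h.law_ctx t)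

/-- The sampled and the true parameter are independent given the observations. -/
theorem hasCondDistrib_param_obs_sample (h : D.IsThompsonSampling Φ P) (t : Fin T) :
    HasCondDistrib D.param (fun ω => (D.obs t ω, D.sample t ω))
      ((D.posterior P t).prodMkRight O) P :=
  (h.hasCondDistrib_param_obs t).swap_of_prodMkRight (η := D.posterior P t) (h.law_sample t)

theorem hasCondDistrib_sample_obs (h : D.IsThompsonSampling Φ P) (t : Fin T) :
    HasCondDistrib (D.sample t) (D.obs t) (D.posterior P t) P := by
  have h1 := (h.hasCondDistrib_param_obs t).snd_compProd (η := (D.posterior P t).prodMkRight O)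
    (h.law_sample t)
  have h2 : (D.posterior P t ⊗ₖ (D.posterior P t).prodMkRight O).snd = D.posterior P t := by
    ext1 y
    rw [Kernel.snd_apply, Kernel.compProd_prodMkRight_apply, ← Measure.snd, Measure.snd_prod]
  rwa [h2] at h1

/-- The law of the reward of an action that is a function of the observations, of the sampled and of
the true parameter. -/
theorem hasCondDistrib_potential_select (h : D.IsThompsonSampling Φ P) (t : Fin T)
    {b : ((Set.Iio t → A × 𝒳 × ℝ) × 𝒳) × O × O → A} (hb : Measurable b) :
    HasCondDistrib (fun ω => D.potential t (b (D.obs t ω, D.sample t ω, D.param ω)) ω)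
      (fun ω => (D.obs t ω, D.sample t ω, D.param ω))
      (Φ.reward.comap (fun q => (q.1.2, b q, q.2.2)) (by fun_prop)) P := by
  have := Φ.reward_markov
  exact HasCondDistrib.select
    ((h.measurable_obs t).prodMk ((h.measurable_sample t).prodMk h.measurable_param)) hb
    (h.measurable_potential t) (h.law_potential t) (fun _ => rfl)

/-- The bound on the lifted information ratio for rewards that are linear in a feature `ι θ` of the
parameter with values in a finite-dimensional space. -/
theorem ae_integrable_and_liftedInfoRatio_le {E : Type*} [Nonempty A] [NormedAddCommGroup E]
    [InnerProductSpace ℝ E] [FiniteDimensional ℝ E] (h : D.IsThompsonSampling Φ P) (ι : O → E)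
    (m : 𝒳 → A → E)
    (hint : ∀ (x : 𝒳) (a : A) (θ : O), Integrable (fun r : ℝ => r) (Φ.reward (x, a, θ)))
    (hlin : ∀ (x : 𝒳) (a : A) (θ : O), Φ.meanReward x a θ = inner ℝ (ι θ) (m x a))
    {v : ℝ≥0} (t : Fin T)
    (hsub : ∀ᵐ y ∂(P.map (fun ω => (D.obs t ω, D.action t ω))),
      IsSubGaussianLaw v (D.condRewardLaw P t y)) :
    ∀ᵐ ω ∂P, Integrable (fun z : ℝ => z) (D.condRegretLaw P t (D.obs t ω)) ∧
      D.liftedInfoRatio P t ω ≤ 2 * v * Module.finrank ℝ E := by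
  have := Φ.reward_markov
  have hψ : Measurable D.rule := h.rule_optimal.measurable
  have hobs := h.measurable_obs t
  have hact := h.measurable_action t
  have hsam := h.measurable_sample t
  have hpar := h.measurable_param
  have hrew := h.measurable_reward t
  have hopt := h.measurable_optReward t
  set Q := D.posterior P t with hQ
  -- `N` is the law of the action given the observations
  let N := (Q ⊗ₖ Kernel.deterministic
    (fun q : ((Set.Iio t → A × 𝒳 × ℝ) × 𝒳) × O => D.rule (q.1.2, q.2)) (by fun_prop)).snd
  have hN (y) : N y = (Q y).map (fun θ => D.rule (y.2, θ)) := by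
    rw [Kernel.snd_compProd_apply_eq_comp_sectR,
      ← Measure.deterministic_comp_eq_map (f := fun θ => D.rule (y.2, θ)) (by fun_prop)]
    rfl
  have hN' : HasCondDistrib (D.action t) (D.obs t) N P :=
    (h.hasCondDistrib_sample_obs t).snd_compProd
      (hasCondDistrib_deterministic (X := fun ω => (D.obs t ω, D.sample t ω)) (by fun_prop)
        (g := fun q => D.rule (q.1.2, q.2)) (by fun_prop))
  -- the action is a function of the observations and the sample, hence independent of `Θ` too
  have hpar_act : HasCondDistrib D.param (fun ω => (D.obs t ω, D.action t ω))
      (Q.prodMkRight A) P :=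
    HasCondDistrib.comp_right (κ := Q.prodMkRight A)
      (f := fun q : ((Set.Iio t → A × 𝒳 × ℝ) × 𝒳) × O => (q.1, D.rule (q.1.2, q.2)))
      (hf := by fun_prop) (h.hasCondDistrib_param_obs_sample t)
  have hap : HasCondDistrib (fun ω => (D.action t ω, D.param ω)) (D.obs t)
      (N ⊗ₖ Q.prodMkRight A) P := hN'.prodMk hpar_act
  -- `K` is the law of `R_t` given the observations, the action and `Θ`; averaging it over `Θ` gives
  -- the law `S` of `R_t` given the observations and the action
  let K : Kernel (((Set.Iio t → A × 𝒳 × ℝ) × 𝒳) × A × O) ℝ :=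
    Φ.reward.comap (fun q => (q.1.2, q.2.1, q.2.2)) (by fun_prop)
  have hrewZ : HasCondDistrib (D.reward t) (fun ω => (D.obs t ω, D.sample t ω, D.param ω))
      (K.comap (fun q => (q.1, D.rule (q.1.2, q.2.1), q.2.2)) (by fun_prop)) P :=
    h.hasCondDistrib_potential_select t (b := fun q => D.rule (q.1.2, q.2.1)) (by fun_prop)
  have hoptZ : HasCondDistrib (D.optReward t) (fun ω => (D.obs t ω, D.sample t ω, D.param ω))
      (K.comap (fun q => (q.1, D.rule (q.1.2, q.2.2), q.2.2)) (by fun_prop)) P :=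
    h.hasCondDistrib_potential_select t (b := fun q => D.rule (q.1.2, q.2.2)) (by fun_prop)
  have hrew₁ : HasCondDistrib (D.reward t) (fun ω => (D.obs t ω, D.action t ω, D.param ω)) K P :=
    HasCondDistrib.comp_right
      (f := fun q : ((Set.Iio t → A × 𝒳 × ℝ) × 𝒳) × O × O =>
        (q.1, D.rule (q.1.2, q.2.1), q.2.2)) (hf := by fun_prop) hrewZ
  have hrew₂ : HasCondDistrib (D.reward t) (fun ω => ((D.obs t ω, D.action t ω), D.param ω))
      (K.comap MeasurableEquiv.prodAssoc (by fun_prop)) P :=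
    hrew₁.measurableEquiv_comp_right MeasurableEquiv.prodAssoc.symm
  let S := (Q.prodMkRight A ⊗ₖ K.comap MeasurableEquiv.prodAssoc (by fun_prop)).snd
  have hrew₃ : HasCondDistrib (D.reward t) (fun ω => (D.obs t ω, D.action t ω)) S P :=
    hpar_act.snd_compProd hrew₂
  have hrew₄ : HasCondDistrib (D.reward t) (D.obs t) (N ⊗ₖ S).snd P := hN'.snd_compProd hrew₃
  let K' : Kernel (((Set.Iio t → A × 𝒳 × ℝ) × 𝒳) × O) ℝ :=
    K.comap (fun q => (q.1, D.rule (q.1.2, q.2), q.2)) (by fun_prop)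
  have hopt₁ : HasCondDistrib (D.optReward t) (fun ω => (D.obs t ω, D.param ω)) K' P :=
    HasCondDistrib.comp_right (κ := K')
      (f := fun q : ((Set.Iio t → A × 𝒳 × ℝ) × 𝒳) × O × O => (q.1, q.2.2)) (hf := by fun_prop)
      hoptZ
  have hopt₂ : HasCondDistrib (D.optReward t) (D.obs t) (Q ⊗ₖ K').snd P :=
    (h.hasCondDistrib_param_obs t).snd_compProd hopt₁
  -- the chosen versions of the conditional laws agree with the explicit kernels, for almost every
  -- value `y` of the observations
  have e1 := hap.condDistrib_ae_eq
  have e2 : ∀ᵐ y ∂P.map (D.obs t), ∀ᵐ p ∂(N ⊗ₖ Q.prodMkRight A) y,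
      D.condRewardLawParam P t (y, p) = K (y, p) := by
    refine Measure.ae_ae_of_ae_compProd (p := fun q => D.condRewardLawParam P t q = K q) ?_
    rw [← hap.map_eq]
    exact hrew₁.condDistrib_ae_eq
  have e3 : ∀ᵐ y ∂P.map (D.obs t), ∀ᵐ a ∂N y, D.condRewardLaw P t (y, a) = S (y, a) := by
    refine Measure.ae_ae_of_ae_compProd (p := fun q => D.condRewardLaw P t q = S q) ?_
    rw [← hN'.map_eq]
    exact hrew₃.condDistrib_ae_eq
  have e4 : ∀ᵐ y ∂P.map (D.obs t), ∀ᵐ a ∂N y, IsSubGaussianLaw v (D.condRewardLaw P t (y, a)) := by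
    refine Measure.ae_ae_of_ae_compProd
      (p := fun q => IsSubGaussianLaw v (D.condRewardLaw P t q)) ?_
    rw [← hN'.map_eq]
    exact hsub
  -- the coupling of `R⋆_t` and `R_t` is not determined by the model, so `C` stays abstract: its
  -- marginals determine the mean of the difference
  have hpair := hasCondDistrib_condDistrib (P := P) hobs (hopt.prodMk hrew)
  set C := condDistrib (fun ω => (D.optReward t ω, D.reward t ω)) (D.obs t) P with hC
  have e5 : D.condRegretLaw P t =ᵐ[P.map (D.obs t)] C.map fun p => p.1 - p.2 :=
    (hpair.comp_left (f := fun p : ℝ × ℝ => p.1 - p.2) (by fun_prop)).condDistrib_ae_eq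
  have e6 : C.fst =ᵐ[P.map (D.obs t)] (Q ⊗ₖ K').snd :=
    hpair.fst.condDistrib_ae_eq.symm.trans hopt₂.condDistrib_ae_eq
  have e7 : C.snd =ᵐ[P.map (D.obs t)] (N ⊗ₖ S).snd :=
    hpair.snd.condDistrib_ae_eq.symm.trans hrew₄.condDistrib_ae_eq
  have key : ∀ᵐ y ∂P.map (D.obs t), Integrable (fun z : ℝ => z) (D.condRegretLaw P t y) ∧
      ENNReal.ofReal ((∫ z, z ∂(D.condRegretLaw P t y)) ^ 2) /
        (∫⁻ p, klDiv (D.condRewardLawParam P t (y, p)) (D.condRewardLaw P t (y, p.1))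
          ∂(condDistrib (fun ω' => (D.action t ω', D.param ω')) (D.obs t) P y))
        ≤ 2 * v * Module.finrank ℝ E := by
    filter_upwards [e1, e2, e3, e4, e5, e6, e7] with y e1 e2 e3 e4 e5 e6 e7
    have hb : Measurable fun θ => D.rule (y.2, θ) := by fun_prop
    rw [e1, e5, Kernel.map_apply _ (by fun_prop)]
    rw [Kernel.compProd_prodMkRight_apply, hN] at e2 ⊢
    rw [hN] at e3 e4
    have hI : ∫⁻ p, klDiv (D.condRewardLawParam P t (y, p)) (D.condRewardLaw P t (y, p.1))
          ∂(((Q y).map fun θ => D.rule (y.2, θ)).prod (Q y))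
        = ∫⁻ p, klDiv (K.sectR y p) (S.sectR y p.1)
          ∂(((Q y).map fun θ => D.rule (y.2, θ)).prod (Q y)) := by
      refine lintegral_congr_ae ?_
      filter_upwards [e2, Measure.quasiMeasurePreserving_fst.ae e3] with p hp hp'
      rw [hp, hp', Kernel.sectR_apply, Kernel.sectR_apply]
    rw [hI]
    refine integrable_sub_and_sq_div_klDiv_le hb ι (m y.2) (K.sectR y) (fun p => hint _ _ _)
      (fun a θ => hlin _ _ _) (S.sectR y) (fun a => ?_) ?_ (C y) ?_ ?_
    · exact Kernel.snd_compProd_apply_eq_comp_sectR _ _ _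
    · filter_upwards [e3, e4] with a h3 h4
      rw [Kernel.sectR_apply, ← h3]
      exact h4
    · rw [← Kernel.fst_apply, e6, Kernel.snd_compProd_apply_eq_comp_sectR]
      rfl
    · rw [← Kernel.snd_apply, e7, Kernel.snd_compProd_apply_eq_comp_sectR, hN]
  exact ae_of_ae_map hobs.aemeasurable key

end BanditRun.IsThompsonSampling

theorem lemma2 {Ω 𝒳 A : Type*} [MeasurableSpace Ω] [MeasurableSpace 𝒳]
    [MeasurableSpace A] [DiscreteMeasurableSpace A] [Finite A] [Nonempty A]
    {d T : ℕ} (O : Set (EuclideanSpace ℝ (Fin d))) [StandardBorelSpace O] [Nonempty O]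
    (P : Measure Ω) [IsProbabilityMeasure P]
    (Φ : ContextualBandit 𝒳 A O) (D : BanditRun Ω 𝒳 A O T)
    (hTS : D.IsThompsonSampling Φ P)
    (m : 𝒳 → A → EuclideanSpace ℝ (Fin d))
    (hint : ∀ (x : 𝒳) (a : A) (θ : O), Integrable (fun r : ℝ => r) (Φ.reward (x, a, θ)))
    (hlin : ∀ (x : 𝒳) (a : A) (θ : O),
      Φ.meanReward x a θ = inner ℝ (θ : EuclideanSpace ℝ (Fin d)) (m x a))
    (σ : ℝ≥0)
    (hsub : ∀ t : Fin T, ∀ᵐ y ∂(P.map (fun ω => (D.obs t ω, D.action t ω))),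
      IsSubGaussianLaw (σ ^ 2) (D.condRewardLaw P t y)) :
    ∀ t : Fin T, ∀ᵐ ω ∂P,
      Integrable (fun z : ℝ => z) (D.condRegretLaw P t (D.obs t ω)) ∧
      D.liftedInfoRatio P t ω ≤ 2 * (σ : ℝ≥0∞) ^ 2 * (d : ℝ≥0∞) := by
  intro t
  simpa using hTS.ae_integrable_and_liftedInfoRatio_le
    (fun θ : O => (θ : EuclideanSpace ℝ (Fin d))) m hint hlin t (hsub t)
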